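/- Let $\{S_i\}_{i=1}^m$ be a finite family of contracting similarities of $\mathbb{R}^d$, i.e. for each $i$ there is $r_i\in(0,1)$ with $\|S_i(x)-S_i(y)\|=r_i\|x-y\|$ for all $x,y\in\mathbb{R}^d$. Let $K\subseteq\mathbb{R}^d$ be its attractor, i.e. the unique nonempty compact set with $K=\bigcup_{i=1}^m S_i(K)$; no separation condition is assumed. Let $t=\dim_H K$ be the Hausdorff dimension of $K$ and let $\mathcal{H}^t$ denote $t$-dimensional Hausdorff (outer) measure. Let $L:\mathbb{R}^d\to\mathbb{R}^{d_2}$ be a linear map, and let $A,B\subseteq K$ be such that $\mathcal{H}^t(A\cap B)=0$ and $A$ is $\mathcal{H}^t$-measurable, i.e. $\mathcal{H}^t(H)=\mathcal{H}^t(H\setminus A)+\mathcal{H}^t(H\cap A)$ for every $H\subseteq\mathbb{R}^d$. Then $$\mathcal{H}^t\bigl(L(A)\cap L(B)\bigr)=0.$$ In particular, this holds whenever $A,B\subseteq K$ are disjoint and $A$ is $\mathcal{H}^t$-measurable. -/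

import Mathlib

open MeasureTheory

/-- A contracting similarity: all distances are scaled by one common ratio `r ∈ (0, 1)`. -/
def IsContractingSimilarity {d : ℕ}
    (S : EuclideanSpace ℝ (Fin d) → EuclideanSpace ℝ (Fin d)) : Prop :=
  ∃ r : ℝ, 0 < r ∧ r < 1 ∧ ∀ x y, dist (S x) (S y) = r * dist x y

/-- A self-similar iterated function system: a finite family of contracting similarities
of `ℝ^d`. -/
def IsSelfSimilarIFS {d m : ℕ}
    (S : Fin m → EuclideanSpace ℝ (Fin d) → EuclideanSpace ℝ (Fin d)) : Prop :=
  ∀ i, IsContractingSimilarity (S i)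

/-- `K` is the attractor of the family `S`: a nonempty compact set with `K = ⋃ i, S i (K)`. -/
structure IsAttractor {d m : ℕ}
    (S : Fin m → EuclideanSpace ℝ (Fin d) → EuclideanSpace ℝ (Fin d))
    (K : Set (EuclideanSpace ℝ (Fin d))) : Prop where
  nonempty : K.Nonempty
  isCompact : IsCompact K
  eq_iUnion : K = ⋃ i, S i '' K

/-- A set `A ⊆ ℝ^d` is `ℋ^s`-measurable (Carathéodory's criterion):
`ℋ^s(H) = ℋ^s(H \ A) + ℋ^s(H ∩ A)` for every set `H ⊆ ℝ^d`. -/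
def IsHausdorffMeasurable {d : ℕ} (s : ℝ) (A : Set (EuclideanSpace ℝ (Fin d))) : Prop :=
  ∀ H : Set (EuclideanSpace ℝ (Fin d)), μH[s] H = μH[s] (H \ A) + μH[s] (H ∩ A)

/-! Write `S_i x = r_i O_i x + b_i` with `O_i` a linear isometry, and for a word `w` let `r_w`,
`O_w` be the products. Assume `t > 0` and `0 < H^t(K)`, and let `M` be the supremum over `w` of the
Hausdorff content (covers of any diameter) of `L O_w K`. Two facts pin `M` down.

Upper bound (`hausdorffMeasure_image_le`): `H^t(L A) ≤ (M / H^t(K)) H^t(A)` for every `A ⊆ K`. The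
image of a piece `S_w K` is a translated copy of `L O_w K` scaled by `r_w`, so its content is at
most `r_w^t M`, while the piece has measure `r_w^t H^t(K)`. For tiny pieces content bounds the
fine-scale premeasure, and disjoint tiny pieces exhaust a relatively open part of `K` geometrically
fast.

Lower bound (`orbitContent_le_content`): the content of `L K` is at least `M`. Otherwise, for any
`w`, some `v` from a fixed finite set makes `O_w O_v` nearly the identity; the part of `L O_w K`
coming from the piece of `v` then has too little content, the upper bound controls the rest, and the
content of `L O_w K` falls short of `M` by a uniform amount.

Hence `H^t(L A) + H^t(L(K \ A)) ≤ M ≤ H^t(L K)`, the measurability of `A` being needed only against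
`K`. So `L A` and `L(K \ A)` overlap in a null set, and `L(A ∩ B)` is null since `L` is Lipschitz.

Overlaps among the pieces are harmless: disjoint pieces of ratio at least `σ` number at most
`σ^(-t)`, since more would form a separated subsystem of dimension above `t`. This gives `H^t(K) <
∞` and finite maximal disjoint families. -/

namespace SelfSimilar

open Set Filter Topology Metric
open scoped ENNReal NNReal

/-! ### Hausdorff premeasures and content -/

section Content

variable {X : Type*} [EMetricSpace X]

/-- The `t`-dimensional Hausdorff premeasure of scale `δ`: coverings by sets of diameter at
most `δ` are allowed. For `δ = ∞` this is the Hausdorff content. -/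
noncomputable def hausdorffPre (t : ℝ) (δ : ℝ≥0∞) : OuterMeasure X :=
  OuterMeasure.mkMetric'.pre (fun s => ediam s ^ t) δ

theorem le_hausdorffPre {t : ℝ} {δ : ℝ≥0∞} {μ : OuterMeasure X}
    (h : ∀ s : Set X, ediam s ≤ δ → μ s ≤ ediam s ^ t) : μ ≤ hausdorffPre t δ :=
  OuterMeasure.mkMetric'.le_pre.2 h

theorem hausdorffPre_le {t : ℝ} {δ : ℝ≥0∞} {s : Set X} (h : ediam s ≤ δ) :
    hausdorffPre t δ s ≤ ediam s ^ t :=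
  OuterMeasure.mkMetric'.pre_le (m := fun s => ediam s ^ t) h

theorem hausdorffPre_mono (t : ℝ) {δ δ' : ℝ≥0∞} (h : δ ≤ δ') (s : Set X) :
    hausdorffPre t δ' s ≤ hausdorffPre t δ s :=
  OuterMeasure.mkMetric'.mono_pre _ h s

/-- Intersecting the covering sets with `s` makes them admissible at scale `δ` at no cost. This
turns content bounds for small pieces into premeasure bounds. -/
theorem hausdorffPre_le_top_of_ediam_le (t : ℝ) {δ : ℝ≥0∞} {s : Set X}
    (h : ediam s ≤ δ) (ht : 0 ≤ t) :
    hausdorffPre t δ s ≤ hausdorffPre t ∞ s := by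
  have : OuterMeasure.restrict s (hausdorffPre t δ) ≤ hausdorffPre t ∞ := by
    refine le_hausdorffPre fun u _ => ?_
    rw [OuterMeasure.restrict_apply]
    exact (hausdorffPre_le ((ediam_mono inter_subset_right).trans h)).trans
      (ENNReal.rpow_le_rpow (ediam_mono inter_subset_left) ht)
  simpa using this s

variable [MeasurableSpace X] [BorelSpace X]

theorem hausdorffMeasure_eq_iSup_pre (t : ℝ) (s : Set X) :
    μH[t] s = ⨆ δ > 0, hausdorffPre t δ s := by
  have : μH[t] s = OuterMeasure.mkMetric (fun r => r ^ t) s := by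
    rw [OuterMeasure.coe_mkMetric]; rfl
  rw [this]
  simp [OuterMeasure.mkMetric, OuterMeasure.mkMetric', hausdorffPre, OuterMeasure.iSup_apply]

theorem hausdorffPre_le_hausdorffMeasure (t : ℝ) {δ : ℝ≥0∞} (hδ : 0 < δ) (s : Set X) :
    hausdorffPre t δ s ≤ μH[t] s := by
  rw [hausdorffMeasure_eq_iSup_pre]
  exact le_iSup₂ (f := fun δ (_ : δ > 0) => hausdorffPre t δ s) δ hδ

theorem hausdorffMeasure_le_of_forall_pre {t : ℝ} {s : Set X} {a ε : ℝ≥0∞} (hε : 0 < ε)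
    (h : ∀ δ, 0 < δ → δ ≤ ε → hausdorffPre t δ s ≤ a) : μH[t] s ≤ a := by
  rw [hausdorffMeasure_eq_iSup_pre]
  refine iSup₂_le fun δ hδ => ?_
  exact (hausdorffPre_mono t (min_le_left δ ε) s).trans
    (h _ (lt_min hδ hε) (min_le_right _ _))

end Content

/-! ### Open covers and upper semicontinuity of content -/

section Cover

variable {X : Type*} [MetricSpace X]

theorem exists_thickening_rpow_le {t : ℝ} (ht : 0 < t) (s : Set X) {ε : ℝ≥0∞} (hε : 0 < ε) :
    ∃ δ : ℝ≥0, 0 < δ ∧ ediam (thickening δ s) ^ t ≤ ediam s ^ t + ε := by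
  by_cases hs : ediam s = ∞
  · exact ⟨1, one_pos, by simp [hs, ht]⟩
  have hc : Tendsto (fun δ : ℝ≥0 => (ediam s + 2 * (δ : ℝ≥0∞)) ^ t) (𝓝 0) (𝓝 (ediam s ^ t)) := by
    have h1 : Tendsto (fun δ : ℝ≥0 => ediam s + 2 * (δ : ℝ≥0∞)) (𝓝 0) (𝓝 (ediam s)) := by
      have h2 : Tendsto (fun δ : ℝ≥0 => 2 * (δ : ℝ≥0∞)) (𝓝 0) (𝓝 (2 * ((0 : ℝ≥0) : ℝ≥0∞))) :=
        ENNReal.Tendsto.const_mul (ENNReal.tendsto_coe.2 tendsto_id) (by simp)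
      simpa using (tendsto_const_nhds (x := ediam s)).add h2
    exact (ENNReal.continuous_rpow_const.tendsto _).comp h1
  have hlt : ediam s ^ t < ediam s ^ t + ε :=
    ENNReal.lt_add_right (ENNReal.rpow_ne_top_of_nonneg ht.le hs) hε.ne'
  have := (hc.eventually (eventually_lt_nhds hlt))
  have h3 : ∃ᶠ δ : ℝ≥0 in 𝓝[>] 0, True := by
    simp only [frequently_true_iff_neBot]; infer_instance
  obtain ⟨δ, h4, h5⟩ := ((h3.and_eventually (this.filter_mono nhdsWithin_le_nhds)).and_eventually
    self_mem_nhdsWithin).exists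
  exact ⟨δ, h5, (ENNReal.rpow_le_rpow (ediam_thickening_le δ) ht.le).trans h4.2.le⟩

theorem exists_open_cover_of_content_lt {t : ℝ} (ht : 0 < t) {s : Set X} {η : ℝ≥0∞}
    (h : hausdorffPre t ∞ s < η) :
    ∃ U : ℕ → Set X, (∀ n, IsOpen (U n)) ∧ s ⊆ ⋃ n, U n ∧ ∑' n, ediam (U n) ^ t < η := by
  rw [hausdorffPre, OuterMeasure.mkMetric'.pre, OuterMeasure.boundedBy_apply] at h
  simp only [iInf_lt_iff] at h
  obtain ⟨V, hV, hlt⟩ := h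
  have hle : ∑' n, ediam (V n) ^ t < η := by
    refine lt_of_le_of_lt (ENNReal.tsum_le_tsum fun n => ?_) hlt
    rcases (V n).eq_empty_or_nonempty with h0 | h0
    · simp [h0, ht]
    · refine le_iSup_of_le h0 ?_
      simp [extend]
  obtain ⟨ε, hε, hε'⟩ := ENNReal.exists_pos_sum_of_countable'
    (tsub_pos_of_lt hle).ne' ℕ
  choose δ hδ hδ' using fun n => exists_thickening_rpow_le ht (V n) (hε n)
  refine ⟨fun n => thickening (δ n) (V n), fun n => isOpen_thickening,
    hV.trans (iUnion_mono fun n => self_subset_thickening (by exact_mod_cast hδ n) _), ?_⟩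
  calc ∑' n, ediam (thickening (δ n) (V n)) ^ t ≤ ∑' n, (ediam (V n) ^ t + ε n) :=
        ENNReal.tsum_le_tsum hδ'
    _ = ∑' n, ediam (V n) ^ t + ∑' n, ε n := ENNReal.tsum_add
    _ < ∑' n, ediam (V n) ^ t + (η - ∑' n, ediam (V n) ^ t) :=
        (ENNReal.add_lt_add_iff_left hle.ne_top).2 hε'
    _ = η := add_tsub_cancel_of_le hle.le

/-- An open cover of a compact set also covers a thickening of it; this is the upper semicontinuity
that the measure itself lacks. -/
theorem exists_thickening_content_le {t : ℝ} (ht : 0 < t) {K : Set X} (hK : IsCompact K)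
    {η : ℝ≥0∞} (h : hausdorffPre t ∞ K < η) :
    ∃ ε : ℝ, 0 < ε ∧ hausdorffPre t ∞ (thickening ε K) ≤ η := by
  obtain ⟨U, hU, hKU, hlt⟩ := exists_open_cover_of_content_lt ht h
  obtain ⟨ε, hε, hsub⟩ := hK.exists_thickening_subset_open (isOpen_iUnion hU) hKU
  refine ⟨ε, hε, (measure_mono hsub).trans ((measure_iUnion_le _).trans ?_)⟩
  exact (ENNReal.tsum_le_tsum fun n => hausdorffPre_le le_top).trans hlt.le

end Cover

/-! ### Content under Lipschitz maps -/

section Scaling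

variable {X Y : Type*} [EMetricSpace X] [EMetricSpace Y]

theorem content_image_le {t : ℝ} (ht : 0 ≤ t) {f : X → Y} {C : ℝ≥0} (hC : C ≠ 0)
    (hf : LipschitzWith C f) (s : Set X) :
    hausdorffPre t ∞ (f '' s) ≤ (C : ℝ≥0∞) ^ t * hausdorffPre t ∞ s := by
  have h0 : (C : ℝ≥0∞) ^ t ≠ 0 := by
    simp [ENNReal.rpow_eq_zero_iff, hC]
  have h1 : (C : ℝ≥0∞) ^ t ≠ ∞ := ENNReal.rpow_ne_top_of_nonneg ht ENNReal.coe_ne_top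
  have key : ((C : ℝ≥0∞) ^ t)⁻¹ • OuterMeasure.comap f (hausdorffPre t ∞) ≤ hausdorffPre t ∞ := by
    refine le_hausdorffPre fun u _ => ?_
    rw [smul_apply, OuterMeasure.comap_apply, smul_eq_mul,
      ENNReal.inv_mul_le_iff h0 h1, ← ENNReal.mul_rpow_of_nonneg _ _ ht]
    exact (hausdorffPre_le le_top).trans (ENNReal.rpow_le_rpow (hf.ediam_image_le u) ht)
  have := key s
  rwa [smul_apply, OuterMeasure.comap_apply, smul_eq_mul,
      ENNReal.inv_mul_le_iff h0 h1] at this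

end Scaling

/-! ### Positive measure for separated systems -/

section SeparatedSystem

variable {X ι : Type*} [MetricSpace X] [Fintype ι] {K : Set X} {f : ι → X → X} {ρ : ι → ℝ≥0}

/-- A mass distribution argument without a measure: a finite cover by sets of diameter below the gap
splits into disjoint covers of the images `f i '' K`. Pulled back to `K`, each has fewer members, so
induction on the size applies. -/
theorem rpow_gap_le_sum_ediam [Nontrivial ι] (hne : K.Nonempty)
    (hf : ∀ i x y, edist (f i x) (f i y) = ρ i * edist x y) (hfK : ∀ i, MapsTo (f i) K K)
    {δ : ℝ≥0∞} (hsep : ∀ i j, i ≠ j → ∀ x ∈ K, ∀ y ∈ K, δ ≤ edist (f i x) (f j y))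
    {s : ℝ} (hs : 0 ≤ s) (hρ : 1 ≤ ∑ i, (ρ i : ℝ≥0∞) ^ s) (n : ℕ) :
    ∀ (J : Finset ℕ) (U : ℕ → Set X), J.card = n → K ⊆ ⋃ j ∈ J, U j →
      δ ^ s ≤ ∑ j ∈ J, ediam (U j) ^ s := by
  classical
  induction n using Nat.strong_induction_on with
  | _ n ih =>
    intro J U hJ hKU
    by_cases hbig : ∃ j ∈ J, δ ≤ ediam (U j)
    · obtain ⟨j, hj, hle⟩ := hbig
      exact (ENNReal.rpow_le_rpow hle hs).trans
        (Finset.single_le_sum (f := fun j => ediam (U j) ^ s) (fun _ _ => zero_le) hj)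
    push Not at hbig
    set P : ι → Finset ℕ := fun i => J.filter fun j => (U j ∩ f i '' K).Nonempty with hP
    have hdisj : ∀ i i', i ≠ i' → Disjoint (P i) (P i') := by
      intro i i' hii
      rw [Finset.disjoint_left]
      intro j hj hj'
      obtain ⟨hjJ, _, hx, x, hxK, rfl⟩ := Finset.mem_filter.1 hj
      obtain ⟨_, _, hy, y, hyK, rfl⟩ := Finset.mem_filter.1 hj'
      exact (hbig j hjJ).not_ge ((hsep i i' hii x hxK y hyK).trans (edist_le_ediam_of_mem hx hy))
    have hcov : ∀ i, K ⊆ ⋃ j ∈ P i, f i ⁻¹' U j := by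
      intro i x hx
      obtain ⟨j, hj, hxj⟩ := mem_iUnion₂.1 (hKU (hfK i hx))
      exact mem_iUnion₂.2 ⟨j, Finset.mem_filter.2 ⟨hj, _, hxj, x, hx, rfl⟩, hxj⟩
    have hPne : ∀ i, (P i).Nonempty := by
      intro i
      obtain ⟨x, hx⟩ := hne
      obtain ⟨j, hj, _⟩ := mem_iUnion₂.1 (hcov i hx)
      exact ⟨j, hj⟩
    -- A second index exists, and its image needs a covering set that misses the image of index `i`.
    have hcard : ∀ i, (P i).card < n := by
      intro i
      obtain ⟨i', hi'⟩ := exists_ne i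
      rw [← hJ]
      refine Finset.card_lt_card (Finset.filter_ssubset.2 ?_)
      obtain ⟨j, hj⟩ := hPne i'
      refine ⟨j, (Finset.mem_filter.1 hj).1, fun h => ?_⟩
      exact Finset.disjoint_left.1 (hdisj i' i hi') hj
        (Finset.mem_filter.2 ⟨(Finset.mem_filter.1 hj).1, h⟩)
    have hstep : ∀ i, (ρ i : ℝ≥0∞) ^ s * δ ^ s ≤ ∑ j ∈ P i, ediam (U j) ^ s := by
      intro i
      calc (ρ i : ℝ≥0∞) ^ s * δ ^ s
          ≤ (ρ i : ℝ≥0∞) ^ s * ∑ j ∈ P i, ediam (f i ⁻¹' U j) ^ s := by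
            gcongr
            exact ih _ (hcard i) (P i) _ rfl (hcov i)
        _ = ∑ j ∈ P i, ((ρ i : ℝ≥0∞) * ediam (f i ⁻¹' U j)) ^ s := by
            rw [Finset.mul_sum]
            exact Finset.sum_congr rfl fun j _ => (ENNReal.mul_rpow_of_nonneg _ _ hs).symm
        _ ≤ _ := by
            refine Finset.sum_le_sum fun j _ => ENNReal.rpow_le_rpow ?_ hs
            simp only [ediam, ENNReal.mul_iSup]
            refine iSup₂_le fun x hx => iSup₂_le fun y hy => ?_
            rw [← hf]
            exact edist_le_ediam_of_mem (s := U j) hx hy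
    calc δ ^ s ≤ (∑ i, (ρ i : ℝ≥0∞) ^ s) * δ ^ s := le_mul_of_one_le_left' hρ
      _ = ∑ i, (ρ i : ℝ≥0∞) ^ s * δ ^ s := Finset.sum_mul _ _ _
      _ ≤ ∑ i, ∑ j ∈ P i, ediam (U j) ^ s := Finset.sum_le_sum fun i _ => hstep i
      _ = ∑ j ∈ Finset.univ.biUnion P, ediam (U j) ^ s :=
          (Finset.sum_biUnion fun i _ i' _ h => hdisj i i' h).symm
      _ ≤ _ := Finset.sum_le_sum_of_subset
          (Finset.biUnion_subset.2 fun i _ => Finset.filter_subset _ _)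

theorem exists_gap (hK : IsCompact K) (hf : ∀ i x y, edist (f i x) (f i y) = ρ i * edist x y)
    (hdisj : ∀ i j, i ≠ j → Disjoint (f i '' K) (f j '' K)) :
    ∃ δ : ℝ≥0∞, 0 < δ ∧ ∀ i j, i ≠ j → ∀ x ∈ K, ∀ y ∈ K, δ ≤ edist (f i x) (f j y) := by
  have hcont : ∀ i, Continuous (f i) := fun i =>
    (show LipschitzWith (ρ i) (f i) from fun x y => (hf i x y).le).continuous
  have h : ∀ p : ι × ι, ∃ δ : ℝ≥0∞, 0 < δ ∧ (p.1 ≠ p.2 →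
      ∀ x ∈ K, ∀ y ∈ K, δ ≤ edist (f p.1 x) (f p.2 y)) := by
    intro p
    by_cases hp : p.1 = p.2
    · exact ⟨1, one_pos, fun h => absurd hp h⟩
    obtain ⟨r, hr, hle⟩ := exists_pos_forall_lt_edist (hK.image (hcont p.1))
      (hK.image (hcont p.2)).isClosed (hdisj _ _ hp)
    exact ⟨r, by exact_mod_cast hr, fun _ x hx y hy =>
      (hle _ (mem_image_of_mem _ hx) _ (mem_image_of_mem _ hy)).le⟩
  choose δ hδ hle using h
  refine ⟨Finset.univ.inf δ, ?_, fun i j hij x hx y hy =>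
    (Finset.inf_le (Finset.mem_univ (i, j))).trans (hle (i, j) hij x hx y hy)⟩
  rw [Finset.lt_inf_iff (by simp)]
  exact fun p _ => hδ p

/-- The attractor of a system with at least two pairwise disjoint pieces whose ratios satisfy
`1 ≤ ∑ i, ρ i ^ s` has positive `s`-dimensional Hausdorff measure. -/
theorem hausdorffMeasure_pos_of_disjoint_images [Nontrivial ι] [MeasurableSpace X] [BorelSpace X]
    (hK : IsCompact K) (hne : K.Nonempty)
    (hf : ∀ i x y, edist (f i x) (f i y) = ρ i * edist x y) (hfK : ∀ i, MapsTo (f i) K K)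
    (hdisj : ∀ i j, i ≠ j → Disjoint (f i '' K) (f j '' K))
    {s : ℝ} (hs : 0 < s) (hρ : 1 ≤ ∑ i, (ρ i : ℝ≥0∞) ^ s) : 0 < μH[s] K := by
  obtain ⟨δ, hδ, hsep⟩ := exists_gap hK hf hdisj
  have hδtop : δ ≠ ∞ := by
    obtain ⟨x, hx⟩ := hne
    obtain ⟨i, j, hij⟩ := exists_pair_ne ι
    exact ne_top_of_le_ne_top (edist_ne_top _ _) (hsep i j hij x hx x hx)
  refine lt_of_lt_of_le (ENNReal.rpow_pos (p := s) hδ hδtop)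
    (le_trans ?_ (hausdorffPre_le_hausdorffMeasure s ENNReal.zero_lt_top K))
  by_contra! hlt
  obtain ⟨U, hU, hKU, hlt⟩ := exists_open_cover_of_content_lt hs hlt
  obtain ⟨J, hJ⟩ := hK.elim_finite_subcover U hU hKU
  exact hlt.not_ge ((rpow_gap_le_sum_ediam hne hf hfK hsep hs.le hρ _ J U rfl hJ).trans
    (ENNReal.sum_le_tsum J))

end SeparatedSystem

/-! ### Similarities, words and pieces -/

/-- A family of contracting similarities `x ↦ rᵢ • Oᵢ x + bᵢ` of a normed space. -/
structure SimilarityFamily (ι E : Type*) [NormedAddCommGroup E] [NormedSpace ℝ E] where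
  ratio : ι → ℝ≥0
  lin : ι → E →L[ℝ] E
  trans : ι → E
  ratio_pos : ∀ i, 0 < ratio i
  ratio_lt_one : ∀ i, ratio i < 1
  norm_lin : ∀ i x, ‖lin i x‖ = ‖x‖

namespace SimilarityFamily

variable {ι E : Type*} [NormedAddCommGroup E] [NormedSpace ℝ E] (Φ : SimilarityFamily ι E)

/-- The similarity with index `i`. -/
noncomputable def letterMap (i : ι) (x : E) : E := (Φ.ratio i : ℝ) • Φ.lin i x + Φ.trans i

/-- The contraction ratio of the composition along a word. -/
noncomputable def wordRatio (w : List ι) : ℝ≥0 := (w.map Φ.ratio).prod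

/-- The linear isometry part of the composition along a word. -/
noncomputable def wordLin (w : List ι) : E →L[ℝ] E := (w.map Φ.lin).prod

/-- The composition of similarities along a word. -/
noncomputable def wordMap : List ι → E → E
  | [] => id
  | i :: w => Φ.letterMap i ∘ wordMap w

/-- The image of `K` under the composition of similarities along a word. -/
def piece (K : Set E) (w : List ι) : Set E := Φ.wordMap w '' K

@[simp] theorem wordRatio_nil : Φ.wordRatio [] = 1 := rfl

theorem wordRatio_cons (i : ι) (w : List ι) : Φ.wordRatio (i :: w) = Φ.ratio i * Φ.wordRatio w := by
  simp [wordRatio]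

theorem wordRatio_pos (w : List ι) : 0 < Φ.wordRatio w := by
  induction w with
  | nil => simp
  | cons i w ih => rw [wordRatio_cons]; exact mul_pos (Φ.ratio_pos i) ih

@[simp] theorem wordLin_nil : Φ.wordLin [] = 1 := rfl

theorem wordLin_cons (i : ι) (w : List ι) : Φ.wordLin (i :: w) = Φ.lin i * Φ.wordLin w := by
  simp [wordLin]

theorem wordLin_append (v w : List ι) : Φ.wordLin (v ++ w) = Φ.wordLin v * Φ.wordLin w := by
  simp [wordLin]

theorem norm_wordLin (w : List ι) (x : E) : ‖Φ.wordLin w x‖ = ‖x‖ := by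
  induction w with
  | nil => simp
  | cons i w ih => rw [wordLin_cons, mul_apply_eq_comp, Φ.norm_lin, ih]

theorem wordMap_eq (w : List ι) (x : E) :
    Φ.wordMap w x = (Φ.wordRatio w : ℝ) • Φ.wordLin w x + Φ.wordMap w 0 := by
  induction w generalizing x with
  | nil => simp [wordMap]
  | cons i w ih =>
    simp only [wordMap, Function.comp, letterMap]
    rw [ih x, wordRatio_cons, wordLin_cons]
    simp [mul_smul, add_assoc]

theorem edist_wordMap (w : List ι) (x y : E) :
    edist (Φ.wordMap w x) (Φ.wordMap w y) = Φ.wordRatio w * edist x y := by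
  rw [Φ.wordMap_eq w x, Φ.wordMap_eq w y, edist_add_right, edist_smul₀, edist_eq_enorm_sub,
    edist_eq_enorm_sub x y, ← map_sub, ENNReal.smul_def, smul_eq_mul]
  congr 1
  · simp
  · rw [← ofReal_norm, norm_wordLin, ofReal_norm]

theorem lipschitzWith_wordMap (w : List ι) : LipschitzWith (Φ.wordRatio w) (Φ.wordMap w) :=
  fun x y => (Φ.edist_wordMap w x y).le

variable {Φ} {K : Set E}

theorem mapsTo_wordMap (hinv : K = ⋃ i, Φ.letterMap i '' K) (w : List ι) :
    MapsTo (Φ.wordMap w) K K := by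
  induction w with
  | nil => exact mapsTo_id K
  | cons i w ih =>
    intro x hx
    rw [hinv]
    exact mem_iUnion.2 ⟨i, _, ih hx, rfl⟩

theorem piece_subset (hinv : K = ⋃ i, Φ.letterMap i '' K) (w : List ι) : Φ.piece K w ⊆ K :=
  (mapsTo_wordMap hinv w).image_subset

theorem isCompact_piece (hK : IsCompact K) (w : List ι) : IsCompact (Φ.piece K w) :=
  hK.image (Φ.lipschitzWith_wordMap w).continuous

theorem ediam_piece_le (w : List ι) : ediam (Φ.piece K w) ≤ Φ.wordRatio w * ediam K :=
  (Φ.lipschitzWith_wordMap w).ediam_image_le K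

theorem hausdorffMeasure_piece [MeasurableSpace E] [BorelSpace E] {t : ℝ} (ht : 0 ≤ t)
    (w : List ι) : μH[t] (Φ.piece K w) = (Φ.wordRatio w : ℝ≥0∞) ^ t * μH[t] K := by
  refine le_antisymm ((Φ.lipschitzWith_wordMap w).hausdorffMeasure_image_le ht K) ?_
  have h0 : (Φ.wordRatio w : ℝ≥0∞) ≠ 0 := by exact_mod_cast (Φ.wordRatio_pos w).ne'
  have hanti : AntilipschitzWith (Φ.wordRatio w)⁻¹ (Φ.wordMap w) := fun x y => by
    rw [Φ.edist_wordMap, ← mul_assoc, ENNReal.coe_inv (Φ.wordRatio_pos w).ne',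
      ENNReal.inv_mul_cancel h0 ENNReal.coe_ne_top, one_mul]
  have := hanti.le_hausdorffMeasure_image ht K
  rw [ENNReal.coe_inv (Φ.wordRatio_pos w).ne', ENNReal.inv_rpow] at this
  calc _ ≤ (Φ.wordRatio w : ℝ≥0∞) ^ t *
          (((Φ.wordRatio w : ℝ≥0∞) ^ t)⁻¹ * μH[t] (Φ.wordMap w '' K)) := by
        gcongr
    _ = _ := by
      rw [← mul_assoc, ENNReal.mul_inv_cancel, one_mul]; · rfl
      · simp [ENNReal.rpow_eq_zero_iff, h0]
      · exact ENNReal.rpow_ne_top_of_nonneg ht ENNReal.coe_ne_top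

/-! ### Pieces of a given size and their number -/

/-- Every point lies in a piece of prescribed approximate size. -/
theorem exists_mem_piece [Finite ι] (hne : K.Nonempty) (hinv : K = ⋃ i, Φ.letterMap i '' K) :
    ∃ σ : ℝ≥0, 0 < σ ∧ σ < 1 ∧ ∀ ρ : ℝ≥0, 0 < ρ → ρ ≤ 1 → ∀ x ∈ K,
      ∃ w, x ∈ Φ.piece K w ∧ σ * ρ ≤ Φ.wordRatio w ∧ Φ.wordRatio w ≤ ρ := by
  have : Nonempty ι := by
    obtain ⟨x, hx⟩ := hne
    rw [hinv] at hx
    exact ⟨(mem_iUnion.1 hx).choose⟩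
  obtain ⟨a, ha⟩ := Finite.exists_min Φ.ratio
  obtain ⟨b, hb⟩ := Finite.exists_max Φ.ratio
  refine ⟨Φ.ratio a, Φ.ratio_pos a, Φ.ratio_lt_one a, fun ρ hρ hρ1 => ?_⟩
  -- Follow an address of `x` until the ratio first drops to `ρ`: the last letter overshoots by at
  -- most the smallest ratio, which is `σ`. The exponent `k` bounds the word length.
  have key : ∀ k : ℕ, ∀ ρ : ℝ≥0, Φ.ratio b ^ k ≤ ρ → ρ ≤ 1 → ∀ x ∈ K,
      ∃ w, x ∈ Φ.piece K w ∧ Φ.ratio a * ρ ≤ Φ.wordRatio w ∧ Φ.wordRatio w ≤ ρ := by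
    intro k
    induction k with
    | zero =>
      intro ρ h1 h2 x hx
      refine ⟨[], ⟨x, hx, rfl⟩, ?_, by simpa using h1⟩
      exact mul_le_one' (Φ.ratio_lt_one a).le h2
    | succ k ih =>
      intro ρ h1 h2 x hx
      rw [hinv] at hx
      obtain ⟨i, y, hy, rfl⟩ := mem_iUnion.1 hx
      rcases le_total (Φ.ratio i) ρ with hi | hi
      · refine ⟨[i], ⟨y, hy, rfl⟩, ?_, by simpa [wordRatio_cons] using hi⟩
        rw [wordRatio_cons, wordRatio_nil, mul_one]
        exact (mul_le_of_le_one_right' h2).trans (ha i)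
      · obtain ⟨w, ⟨z, hz, rfl⟩, hw1, hw2⟩ := ih (ρ / Φ.ratio i)
          (by
            rw [le_div_iff₀ (Φ.ratio_pos i)]
            refine le_trans ?_ h1
            rw [pow_succ]
            gcongr
            exact hb i)
          (div_le_one_of_le₀ hi zero_le) y hy
        refine ⟨i :: w, ⟨z, hz, rfl⟩, ?_, ?_⟩
        · rw [wordRatio_cons]
          calc Φ.ratio a * ρ = Φ.ratio i * (Φ.ratio a * (ρ / Φ.ratio i)) := by
                field_simp [(Φ.ratio_pos i).ne']
            _ ≤ _ := by gcongr
        · rw [wordRatio_cons]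
          rwa [le_div_iff₀ (Φ.ratio_pos i), mul_comm] at hw2
  obtain ⟨k, hk⟩ := exists_pow_lt_of_lt_one hρ (Φ.ratio_lt_one b)
  exact key k ρ hk.le hρ1

/-- Disjoint pieces of relative size at least `σ` number at most `σ⁻ᵗ`, `t` being the dimension. -/
theorem card_mul_rpow_le_one [MeasurableSpace E] [BorelSpace E] (hK : IsCompact K)
    (hne : K.Nonempty) (hinv : K = ⋃ i, Φ.letterMap i '' K) {t : ℝ≥0} (hdim : dimH K ≤ t)
    {σ : ℝ≥0} (hσ : 0 < σ) (hσ1 : σ < 1) (W : Finset (List ι)) (hW : ∀ w ∈ W, σ ≤ Φ.wordRatio w)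
    (hdisj : (W : Set (List ι)).PairwiseDisjoint (Φ.piece K)) :
    (W.card : ℝ) * (σ : ℝ) ^ (t : ℝ) ≤ 1 := by
  by_contra! hlt
  have hσ0 : (σ : ℝ) ≠ 0 := by exact_mod_cast hσ.ne'
  have hcard : 1 < W.card := by
    have : (σ : ℝ) ^ (t : ℝ) ≤ 1 :=
      Real.rpow_le_one σ.2 (by exact_mod_cast hσ1.le) t.coe_nonneg
    by_contra! h
    have h' : (W.card : ℝ) ≤ 1 := by exact_mod_cast h
    exact hlt.not_ge (mul_le_one₀ h' (Real.rpow_nonneg σ.2 _) this)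
  -- The strict inequality survives for some exponent `s > t`; then `K` has positive `s`-measure,
  -- against `dimH K ≤ t`.
  have hcont : Continuous fun s : ℝ => (W.card : ℝ) * (σ : ℝ) ^ s :=
    continuous_const.mul (Real.continuous_const_rpow hσ0)
  have hev := hcont.continuousAt.eventually (lt_mem_nhds hlt) 
  obtain ⟨s, hs1, hs2⟩ := ((hev.filter_mono nhdsWithin_le_nhds).and
    (self_mem_nhdsWithin : Ioi (t : ℝ) ∈ 𝓝[>] (t : ℝ))).exists
  have hts : (t : ℝ) < s := hs2
  have hs0 : 0 < s := lt_of_le_of_lt t.coe_nonneg hts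
  have hnt : Nontrivial W := by
    obtain ⟨a, ha, b, hb, hab⟩ := Finset.one_lt_card.1 hcard
    exact ⟨⟨a, ha⟩, ⟨b, hb⟩, fun h => hab (congrArg Subtype.val h)⟩
  have hsum : (1 : ℝ≥0∞) ≤ ∑ w : W, (Φ.wordRatio w : ℝ≥0∞) ^ s := by
    calc (1 : ℝ≥0∞) ≤ W.card * (σ : ℝ≥0∞) ^ s := by
          rw [← ENNReal.coe_rpow_of_ne_zero hσ.ne']
          have : (1 : ℝ≥0) ≤ W.card * σ ^ s := by
            rw [← NNReal.coe_le_coe]; push_cast; exact hs1.le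
          exact_mod_cast this
      _ = ∑ _w : W, (σ : ℝ≥0∞) ^ s := by simp
      _ ≤ _ := Finset.sum_le_sum fun w _ =>
          ENNReal.rpow_le_rpow (by exact_mod_cast hW w w.2) hs0.le
  have hpos := hausdorffMeasure_pos_of_disjoint_images (ι := W) (f := fun w => Φ.wordMap w)
    (ρ := fun w => Φ.wordRatio w) hK hne (fun w => Φ.edist_wordMap w)
    (fun w => mapsTo_wordMap hinv w)
    (fun v w hvw => hdisj v.2 w.2 fun h => hvw (Subtype.ext h)) hs0 hsum
  lift s to ℝ≥0 using hs0.le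
  have h1 := (le_dimH_of_hausdorffMeasure_ne_zero hpos.ne').trans hdim
  have h2 : s ≤ t := by exact_mod_cast h1
  exact absurd hts (not_lt.2 (by exact_mod_cast h2))

/-- Greedy selection stops, because the counting bound caps the size of disjoint families. -/
theorem exists_maximal_disjoint [MeasurableSpace E] [BorelSpace E] (hK : IsCompact K)
    (hne : K.Nonempty) (hinv : K = ⋃ i, Φ.letterMap i '' K) {t : ℝ≥0} (hdim : dimH K ≤ t)
    {σ : ℝ≥0} (hσ : 0 < σ) (hσ1 : σ < 1) (P : List ι → Prop) (hP : ∀ w, P w → σ ≤ Φ.wordRatio w) :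
    ∃ W : Finset (List ι), (∀ w ∈ W, P w) ∧ (W : Set (List ι)).PairwiseDisjoint (Φ.piece K) ∧
      ∀ v, P v → ∃ w ∈ W, ¬ Disjoint (Φ.piece K v) (Φ.piece K w) := by
  classical
  by_contra! h
  have key : ∀ n : ℕ, ∃ W : Finset (List ι), W.card = n ∧ (∀ w ∈ W, P w) ∧
      (W : Set (List ι)).PairwiseDisjoint (Φ.piece K) := by
    intro n
    induction n with
    | zero => exact ⟨∅, by simp⟩
    | succ n ih =>
      obtain ⟨W, hWn, hWP, hW⟩ := ih
      obtain ⟨v, hv, hvW⟩ := h W hWP hW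
      have hvW' : v ∉ W := fun hmem => by
        have := hvW v hmem
        rw [disjoint_self] at this
        exact (hne.image (Φ.wordMap v)).ne_empty this
      refine ⟨insert v W, by rw [Finset.card_insert_of_notMem hvW', hWn], ?_, ?_⟩
      · intro w hw
        rcases Finset.mem_insert.1 hw with rfl | hw
        exacts [hv, hWP w hw]
      · rw [Finset.coe_insert]
        exact hW.insert fun w hw _ => hvW w hw
  have hpos : 0 < (σ : ℝ) ^ (t : ℝ) := Real.rpow_pos_of_pos (by exact_mod_cast hσ) _
  obtain ⟨n, hn⟩ := exists_nat_gt (1 / (σ : ℝ) ^ (t : ℝ))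
  obtain ⟨W, hWn, hWP, hW⟩ := key n
  have := card_mul_rpow_le_one hK hne hinv hdim hσ hσ1 W (fun w hw => hP w (hWP w hw)) hW
  rw [div_lt_iff₀ hpos, ← hWn] at hn
  linarith

end SimilarityFamily

/-! ### Maximal disjoint families: finiteness and exhaustion -/

theorem exists_small_scale (D : ℝ≥0) {δ : ℝ≥0∞} (hδ : 0 < δ) {a : ℝ} (ha : 0 < a) {ε : ℝ≥0}
    (hε : 0 < ε) : ∃ ρ : ℝ≥0, 0 < ρ ∧ ρ ≤ 1 ∧ ρ ≤ ε ∧ (ρ * D : ℝ) ≤ a ∧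
      ((3 * ρ * D : ℝ≥0) : ℝ≥0∞) ≤ δ := by
  have h1 : ∀ᶠ ρ : ℝ≥0 in 𝓝 0, (ρ * D : ℝ) < a := by
    have : Continuous fun ρ : ℝ≥0 => (ρ * D : ℝ) := by fun_prop
    exact (this.tendsto 0).eventually (gt_mem_nhds (by simpa using ha))
  have h2 : ∀ᶠ ρ : ℝ≥0 in 𝓝 0, ((3 * ρ * D : ℝ≥0) : ℝ≥0∞) < δ := by
    have : Continuous fun ρ : ℝ≥0 => ((3 * ρ * D : ℝ≥0) : ℝ≥0∞) :=
      ENNReal.continuous_coe.comp (by fun_prop)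
    exact (this.tendsto 0).eventually (gt_mem_nhds (by simpa using hδ))
  have h3 : ∀ᶠ ρ : ℝ≥0 in 𝓝 0, ρ < 1 := gt_mem_nhds one_pos
  have h4 : ∀ᶠ ρ : ℝ≥0 in 𝓝 0, ρ < ε := gt_mem_nhds hε
  have h5 : ∃ᶠ ρ : ℝ≥0 in 𝓝[>] 0, ρ ∈ Ioi (0 : ℝ≥0) :=
    (eventually_mem_nhdsWithin).frequently
  obtain ⟨ρ, h, a1, a2, a3, a4⟩ := (h5.and_eventually
    ((h1.and (h2.and (h3.and h4))).filter_mono nhdsWithin_le_nhds)).exists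
  exact ⟨ρ, h, a3.le, a4.le, a1.le, a2.le⟩

namespace SimilarityFamily

variable {ι E : Type*} [NormedAddCommGroup E] [NormedSpace ℝ E] {Φ : SimilarityFamily ι E}
  {K : Set E} [MeasurableSpace E] [BorelSpace E]

/-- At each scale, a disjoint family of pieces inside `U` controls the premeasure of the part of
`K` well inside `U`. -/
theorem exists_disjoint_family_hausdorffPre_le (hK : IsCompact K)
    (hne : K.Nonempty) (hinv : K = ⋃ i, Φ.letterMap i '' K) {t : ℝ≥0} (hdim : dimH K ≤ t)
    {σ : ℝ≥0} (hσ : 0 < σ) (hσ1 : σ < 1)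
    (hcut : ∀ ρ : ℝ≥0, 0 < ρ → ρ ≤ 1 → ∀ x ∈ K,
      ∃ w, x ∈ Φ.piece K w ∧ σ * ρ ≤ Φ.wordRatio w ∧ Φ.wordRatio w ≤ ρ)
    {D : ℝ≥0} (hD : ediam K ≤ D) {ρ : ℝ≥0} (hρ : 0 < ρ) (hρ1 : ρ ≤ 1) (U : Set E) :
    ∃ W : Finset (List ι), (∀ w ∈ W, σ * ρ ≤ Φ.wordRatio w ∧ Φ.wordRatio w ≤ ρ ∧
        Φ.piece K w ⊆ U) ∧ (W : Set (List ι)).PairwiseDisjoint (Φ.piece K) ∧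
      hausdorffPre t (3 * ρ * D : ℝ≥0) {x ∈ K | closedBall x (ρ * D) ⊆ U} ≤
        ((3 * D / σ : ℝ≥0) : ℝ≥0∞) ^ (t : ℝ) * ∑ w ∈ W, (Φ.wordRatio w : ℝ≥0∞) ^ (t : ℝ) := by
  obtain ⟨W, hWP, hW, hmax⟩ := exists_maximal_disjoint (Φ := Φ) hK hne hinv hdim
    (mul_pos hσ hρ) (lt_of_le_of_lt (mul_le_of_le_one_right' hρ1) hσ1)
    (fun w => σ * ρ ≤ Φ.wordRatio w ∧ Φ.wordRatio w ≤ ρ ∧ Φ.piece K w ⊆ U) (fun w h => h.1)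
  refine ⟨W, hWP, hW, ?_⟩
  have hpd : ∀ v, Φ.wordRatio v ≤ ρ → ∀ x ∈ Φ.piece K v, ∀ y ∈ Φ.piece K v,
      edist x y ≤ (ρ * D : ℝ≥0) := by
    intro v hv x hx y hy
    refine (edist_le_ediam_of_mem hx hy).trans ((ediam_piece_le v).trans ?_)
    rw [ENNReal.coe_mul]
    gcongr
  -- The piece of size about `ρ` through `x` lies in `U`, so by maximality it meets a chosen piece,
  -- which is thus within `ρ * D` of `x`.
  have hsub : {x ∈ K | closedBall x (ρ * D) ⊆ U} ⊆
      ⋃ w ∈ W, cthickening ((ρ * D : ℝ≥0) : ℝ) (Φ.piece K w) := by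
    rintro x ⟨hxK, hxU⟩
    obtain ⟨v, hxv, hv1, hv2⟩ := hcut ρ hρ hρ1 x hxK
    have hvU : Φ.piece K v ⊆ U := fun y hy => hxU (by
      have := hpd v hv2 y hy x hxv
      rw [edist_nndist, ENNReal.coe_le_coe] at this
      rw [mem_closedBall, dist_nndist]
      exact_mod_cast this)
    obtain ⟨w, hw, hvw⟩ := hmax v ⟨hv1, hv2, hvU⟩
    obtain ⟨y, hyv, hyw⟩ := not_disjoint_iff.1 hvw
    refine mem_iUnion₂.2 ⟨w, hw, ?_⟩
    rw [mem_cthickening_iff, ENNReal.ofReal_coe_nnreal]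
    exact (infEDist_le_edist_of_mem hyw).trans (hpd v hv2 x hxv y hyv)
  have hdiam : ∀ w ∈ W, ediam (cthickening ((ρ * D : ℝ≥0) : ℝ) (Φ.piece K w)) ≤
      (3 * ρ * D : ℝ≥0) := by
    intro w hw
    refine (ediam_cthickening_le _).trans ?_
    calc ediam (Φ.piece K w) + 2 * ((ρ * D : ℝ≥0) : ℝ≥0∞)
        ≤ ((ρ * D : ℝ≥0) : ℝ≥0∞) + 2 * ((ρ * D : ℝ≥0) : ℝ≥0∞) := by
          gcongr
          exact ediam_le fun x hx y hy => hpd w (hWP w hw).2.1 x hx y hy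
      _ = _ := by
          have : 3 * ρ * D = ρ * D + 2 * (ρ * D) := by ring
          rw [this]; push_cast; rfl
  calc hausdorffPre t (3 * ρ * D : ℝ≥0) {x ∈ K | closedBall x (ρ * D) ⊆ U}
      ≤ ∑ w ∈ W, hausdorffPre t (3 * ρ * D : ℝ≥0)
          (cthickening ((ρ * D : ℝ≥0) : ℝ) (Φ.piece K w)) :=
        (measure_mono hsub).trans (measure_biUnion_finset_le W _)
    _ ≤ ∑ w ∈ W, (((3 * D / σ : ℝ≥0) : ℝ≥0∞) * Φ.wordRatio w) ^ (t : ℝ) := by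
        refine Finset.sum_le_sum fun w hw => (hausdorffPre_le (hdiam w hw)).trans ?_
        refine ENNReal.rpow_le_rpow ((hdiam w hw).trans ?_) t.coe_nonneg
        rw [← ENNReal.coe_mul, ENNReal.coe_le_coe]
        calc 3 * ρ * D = 3 * D / σ * (σ * ρ) := by field_simp [hσ.ne']
          _ ≤ _ := by gcongr; exact (hWP w hw).1
    _ = _ := by
        rw [Finset.mul_sum]
        exact Finset.sum_congr rfl fun w _ => ENNReal.mul_rpow_of_nonneg _ _ t.coe_nonneg

/-- At scale `ρ` a maximal disjoint family has at most `(σρ)^(-t)` members, each of ratio at most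
`ρ`, so its sum of `r_w^t` is at most `σ^(-t)`, uniformly in `ρ`. -/
theorem hausdorffMeasure_lt_top [Finite ι] (hK : IsCompact K)
    (hne : K.Nonempty) (hinv : K = ⋃ i, Φ.letterMap i '' K) {t : ℝ≥0} (hdim : dimH K ≤ t) :
    μH[t] K < ∞ := by
  obtain ⟨σ, hσ, hσ1, hcut⟩ := exists_mem_piece hne hinv
  obtain ⟨D, hD⟩ : ∃ D : ℝ≥0, (D : ℝ≥0∞) = ediam K :=
    ⟨_, ENNReal.coe_toNNReal hK.isBounded.ediam_ne_top⟩
  have hσt : 0 < σ ^ (t : ℝ) := NNReal.rpow_pos hσ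
  refine lt_of_le_of_lt (hausdorffMeasure_le_of_forall_pre one_pos
    (a := ((3 * D / σ : ℝ≥0) : ℝ≥0∞) ^ (t : ℝ) * ((σ ^ (t : ℝ))⁻¹ : ℝ≥0)) ?_)
    (ENNReal.mul_lt_top (ENNReal.rpow_lt_top_of_nonneg t.coe_nonneg ENNReal.coe_ne_top)
      ENNReal.coe_lt_top)
  intro δ hδ _
  obtain ⟨ρ, hρ, hρ1, _, _, hle⟩ := exists_small_scale D hδ one_pos one_pos
  obtain ⟨W, hW, hdisj, hpre⟩ := exists_disjoint_family_hausdorffPre_le hK hne hinv hdim hσ hσ1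
    hcut hD.ge hρ hρ1 univ
  have hcard := card_mul_rpow_le_one hK hne hinv hdim (mul_pos hσ hρ)
    (lt_of_le_of_lt (mul_le_of_le_one_right' hρ1) hσ1) W (fun w hw => (hW w hw).1) hdisj
  have hcard' : W.card * (σ * ρ) ^ (t : ℝ) ≤ 1 := by
    rw [← NNReal.coe_le_coe]; push_cast; exact_mod_cast hcard
  simp only [subset_univ, and_true, ofPred_mem_eq] at hpre
  refine (hausdorffPre_mono _ hle K).trans (hpre.trans ?_)
  gcongr
  calc ∑ w ∈ W, (Φ.wordRatio w : ℝ≥0∞) ^ (t : ℝ) ≤ ∑ _w ∈ W, (ρ : ℝ≥0∞) ^ (t : ℝ) :=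
        Finset.sum_le_sum fun w hw =>
          ENNReal.rpow_le_rpow (by exact_mod_cast (hW w hw).2.1) t.coe_nonneg
    _ = ((W.card * ρ ^ (t : ℝ) : ℝ≥0) : ℝ≥0∞) := by
        rw [Finset.sum_const, nsmul_eq_mul, ENNReal.coe_mul,
          ENNReal.coe_rpow_of_nonneg _ t.coe_nonneg]
        simp
    _ ≤ _ := by
        rw [ENNReal.coe_le_coe, ← one_div, le_div_iff₀ hσt]
        rw [NNReal.mul_rpow] at hcard'
        calc _ = W.card * (σ ^ (t : ℝ) * ρ ^ (t : ℝ)) := by ring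
          _ ≤ 1 := hcard'

theorem hausdorffMeasure_biUnion_piece (hK : IsCompact K) {t : ℝ} (ht : 0 ≤ t)
    {W : Finset (List ι)} (hW : (W : Set (List ι)).PairwiseDisjoint (Φ.piece K)) :
    μH[t] (⋃ w ∈ W, Φ.piece K w) = (∑ w ∈ W, (Φ.wordRatio w : ℝ≥0∞) ^ t) * μH[t] K := by
  rw [measure_biUnion_finset hW fun w _ => (isCompact_piece hK w).measurableSet, Finset.sum_mul]
  exact Finset.sum_congr rfl fun w _ => hausdorffMeasure_piece ht w

/-- Finitely many disjoint small pieces exhaust a fixed proportion of any open part of `K`. -/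
theorem exists_disjoint_family_measure_diff_le [Finite ι] (hK : IsCompact K)
    (hne : K.Nonempty) (hinv : K = ⋃ i, Φ.letterMap i '' K) {t : ℝ≥0} (hdim : dimH K ≤ t)
    (hpos : μH[t] K ≠ 0) :
    ∃ q : ℝ≥0∞, q < 1 ∧ ∀ U : Set E, IsOpen U → ∀ ε : ℝ≥0, 0 < ε →
      ∃ W : Finset (List ι), (∀ w ∈ W, Φ.wordRatio w ≤ ε ∧ Φ.piece K w ⊆ U) ∧
        (W : Set (List ι)).PairwiseDisjoint (Φ.piece K) ∧
        μH[t] ((K ∩ U) \ ⋃ w ∈ W, Φ.piece K w) ≤ q * μH[t] (K ∩ U) := by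
  have hfin := hausdorffMeasure_lt_top hK hne hinv hdim
  obtain ⟨σ, hσ, hσ1, hcut⟩ := exists_mem_piece hne hinv
  obtain ⟨D, hD⟩ : ∃ D : ℝ≥0, (D : ℝ≥0∞) = ediam K :=
    ⟨_, ENNReal.coe_toNNReal hK.isBounded.ediam_ne_top⟩
  -- The added `1` keeps `C` invertible even if `D = 0`.
  set C : ℝ≥0∞ := ((3 * D / σ : ℝ≥0) : ℝ≥0∞) ^ (t : ℝ) + 1 with hC
  have hCtop : C ≠ ∞ := ENNReal.add_ne_top.2
    ⟨ENNReal.rpow_ne_top_of_nonneg t.coe_nonneg ENNReal.coe_ne_top, ENNReal.one_ne_top⟩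
  have hC0 : C ≠ 0 := by simp [hC]
  -- Proportion captured: `2⁻¹` is lost by keeping only points well inside `U`, `C⁻¹` by thickening
  -- the pieces, and `μH[t] K` converts the sum of `r_w^t` into measure.
  set θ : ℝ≥0∞ := C⁻¹ * 2⁻¹ * μH[t] K with hθ
  have hθ0 : θ ≠ 0 := mul_ne_zero (mul_ne_zero (ENNReal.inv_ne_zero.2 hCtop) (by simp)) hpos
  refine ⟨1 - θ, ENNReal.sub_lt_self ENNReal.one_ne_top one_ne_zero hθ0, fun U hU ε hε => ?_⟩
  by_cases h0 : μH[t] (K ∩ U) = 0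
  · exact ⟨∅, by simp, by simp, by simp [h0]⟩
  have hEfin : μH[t] (K ∩ U) ≠ ∞ := ((measure_mono inter_subset_left).trans_lt hfin).ne
  set A : ℕ → Set E := fun n => {x ∈ K | closedBall x (1 / ((n : ℝ) + 1)) ⊆ U} with hA
  have hmono : Monotone A := by
    intro m n hmn x hx
    refine ⟨hx.1, (closedBall_subset_closedBall ?_).trans hx.2⟩
    exact one_div_le_one_div_of_le (by positivity) (by exact_mod_cast Nat.succ_le_succ hmn)
  have hAU : ⋃ n, A n = K ∩ U := by
    ext x
    simp only [hA, mem_iUnion, mem_sep_iff, exists_and_left, mem_inter_iff]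
    refine and_congr_right fun hx => ⟨?_, fun hxU => ?_⟩
    · rintro ⟨n, hn⟩
      exact hn (mem_closedBall_self (by positivity))
    · obtain ⟨r, hr, hrU⟩ := nhds_basis_closedBall.mem_iff.1 (hU.mem_nhds hxU)
      obtain ⟨n, hn⟩ := exists_nat_one_div_lt hr
      exact ⟨n, (closedBall_subset_closedBall hn.le).trans hrU⟩
  have hhalf : μH[t] (K ∩ U) / 2 < ⨆ n, μH[t] (A n) := by
    rw [← hmono.measure_iUnion, hAU]
    exact ENNReal.half_lt_self h0 hEfin
  obtain ⟨n, hn⟩ := lt_iSup_iff.1 hhalf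
  rw [hausdorffMeasure_eq_iSup_pre _ (A n)] at hn
  simp only [lt_iSup_iff] at hn
  obtain ⟨δ, hδ, hn⟩ := hn
  obtain ⟨ρ, hρ, hρ1, hρε, hρn, hρδ⟩ := exists_small_scale D hδ
    (show (0 : ℝ) < 1 / ((n : ℝ) + 1) by positivity) hε
  obtain ⟨W, hW, hdisj, hpre⟩ := exists_disjoint_family_hausdorffPre_le hK hne hinv hdim hσ hσ1
    hcut hD.ge hρ hρ1 U
  refine ⟨W, fun w hw => ⟨(hW w hw).2.1.trans hρε, (hW w hw).2.2⟩, hdisj, ?_⟩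
  set S := ∑ w ∈ W, (Φ.wordRatio w : ℝ≥0∞) ^ (t : ℝ) with hS
  have hle : μH[t] (K ∩ U) / 2 ≤ C * S := by
    refine hn.le.trans ((hausdorffPre_mono _ hρδ _).trans ?_)
    refine (measure_mono ?_).trans (hpre.trans (mul_le_mul_left le_self_add _))
    exact fun x hx => ⟨hx.1, (closedBall_subset_closedBall hρn).trans hx.2⟩
  have hF := hausdorffMeasure_biUnion_piece hK t.coe_nonneg hdisj
  have hFsub : (⋃ w ∈ W, Φ.piece K w) ⊆ K ∩ U :=
    iUnion₂_subset fun w hw => subset_inter (piece_subset hinv w) (hW w hw).2.2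
  have hFmeas : MeasurableSet (⋃ w ∈ W, Φ.piece K w) :=
    Finset.measurableSet_biUnion W fun w _ => (isCompact_piece hK w).measurableSet
  rw [measure_sdiff hFsub hFmeas.nullMeasurableSet (ne_top_of_le_ne_top hEfin (measure_mono hFsub)),
    ENNReal.sub_mul (fun _ _ => hEfin), one_mul]
  refine tsub_le_tsub_left ?_ _
  have hF' : μH[t] (⋃ w ∈ W, Φ.piece K w) = S * μH[t] K := hF
  rw [hF']
  calc θ * μH[t] (K ∩ U) = C⁻¹ * (μH[t] (K ∩ U) / 2) * μH[t] K := by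
        rw [hθ, div_eq_mul_inv]; ring
    _ ≤ C⁻¹ * (C * S) * μH[t] K := by gcongr
    _ = S * μH[t] K := by rw [← mul_assoc, ENNReal.inv_mul_cancel hC0 hCtop, one_mul]

end SimilarityFamily

/-! ### Two tools: null overlaps and perturbed linear images -/

/-- If `μ P + μ Q` does not exceed the finite outer measure of `P ∪ Q`, then `P ∩ Q` is null. No
measurability is needed. -/
theorem measure_inter_eq_zero_of_add_le {X : Type*} [MeasurableSpace X] {μ : Measure X}
    {P Q : Set X} (hfin : μ P + μ Q ≠ ∞) (h : μ P + μ Q ≤ μ (P ∪ Q)) : μ (P ∩ Q) = 0 := by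
  set P' := toMeasurable μ P
  set Q' := toMeasurable μ Q
  have h1 : μ (P' ∪ Q') + μ (P' ∩ Q') = μ P + μ Q := by
    rw [measure_union_add_inter _ (measurableSet_toMeasurable μ Q), measure_toMeasurable,
      measure_toMeasurable]
  have h2 : μ P + μ Q ≤ μ (P' ∪ Q') := h.trans
    (measure_mono (union_subset_union (subset_toMeasurable μ P) (subset_toMeasurable μ Q)))
  have h3 : μ P + μ Q + μ (P' ∩ Q') ≤ μ P + μ Q + 0 := by
    rw [add_zero]
    exact (add_le_add_left h2 _).trans h1.le
  have h4 := (ENNReal.add_le_add_iff_left hfin).1 h3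
  exact measure_mono_null
    (inter_subset_inter (subset_toMeasurable μ P) (subset_toMeasurable μ Q)) (le_zero_iff.1 h4)

/-- For `T` near the identity, `L ∘L T` moves the image of each point of the bounded set `K` only
slightly, so the new image lies in a thin thickening of `L '' K`. -/
theorem exists_content_image_comp_le {E F : Type*} [NormedAddCommGroup E] [NormedSpace ℝ E]
    [NormedAddCommGroup F] [NormedSpace ℝ F] {t : ℝ} (ht : 0 < t) {K : Set E} (hK : IsCompact K)
    (L : E →L[ℝ] F) {η : ℝ≥0∞} (h : hausdorffPre t ∞ (L '' K) < η) :
    ∃ δ : ℝ, 0 < δ ∧ ∀ T : E →L[ℝ] E, ‖T - 1‖ < δ → hausdorffPre t ∞ ((L ∘L T) '' K) ≤ η := by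
  obtain ⟨ε, hε, hle⟩ := exists_thickening_content_le ht (hK.image L.continuous) h
  obtain ⟨R, hR, hKR⟩ := hK.isBounded.exists_pos_norm_le
  have hpos : 0 < ‖L‖ * R + 1 := by positivity
  refine ⟨ε / (‖L‖ * R + 1), by positivity, fun T hT => (measure_mono ?_).trans hle⟩
  rintro _ ⟨x, hx, rfl⟩
  refine mem_thickening_iff.2 ⟨L x, mem_image_of_mem _ hx, ?_⟩
  rw [lt_div_iff₀ hpos] at hT
  calc dist ((L ∘L T) x) (L x) = ‖L ((T - 1) x)‖ := by
        rw [dist_eq_norm]; simp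
    _ ≤ ‖L‖ * (‖T - 1‖ * ‖x‖) :=
        (L.le_opNorm _).trans (by gcongr; exact (T - 1).le_opNorm x)
    _ ≤ ‖L‖ * (‖T - 1‖ * R) := by gcongr; exact hKR x hx
    _ ≤ ‖T - 1‖ * (‖L‖ * R + 1) := by nlinarith [norm_nonneg (T - 1)]
    _ < ε := hT

/-! ### The semigroup of linear parts and the orbit content -/

namespace SimilarityFamily

variable {ι E F : Type*} [NormedAddCommGroup E] [NormedSpace ℝ E] [NormedAddCommGroup F]
  [NormedSpace ℝ F] {Φ : SimilarityFamily ι E} {K : Set E}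

theorem wordRatio_le_one (w : List ι) : Φ.wordRatio w ≤ 1 := by
  induction w with
  | nil => simp
  | cons i w ih => rw [wordRatio_cons]; exact mul_le_one' (Φ.ratio_lt_one i).le ih

theorem norm_wordLin_mul (w : List ι) (T : E →L[ℝ] E) : ‖Φ.wordLin w * T‖ = ‖T‖ :=
  ContinuousLinearMap.opNorm_ext _ _ fun x => Φ.norm_wordLin w (T x)

theorem exists_wordLin_eq_pow (w : List ι) (n : ℕ) : ∃ v, Φ.wordLin v = Φ.wordLin w ^ n := by
  induction n with
  | zero => exact ⟨[], by simp⟩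
  | succ n ih =>
    obtain ⟨v, hv⟩ := ih
    exact ⟨v ++ w, by rw [wordLin_append, hv, pow_succ]⟩

variable (Φ) in
/-- Finitely many words contain, up to `δ`, an inverse of the linear part of every word. -/
theorem exists_finite_approx_inverse [FiniteDimensional ℝ E] {δ : ℝ} (hδ : 0 < δ) :
    ∃ V : Set (List ι), V.Finite ∧ ∀ w, ∃ v ∈ V, ‖Φ.wordLin w * Φ.wordLin v - 1‖ < δ := by
  have hproper : ProperSpace (E →L[ℝ] E) := FiniteDimensional.proper ℝ _
  have hsub : range Φ.wordLin ⊆ closedBall 0 1 := by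
    rintro _ ⟨w, rfl⟩
    rw [mem_closedBall_zero_iff]
    exact ContinuousLinearMap.opNorm_le_bound _ zero_le_one fun x => by
      rw [one_mul, norm_wordLin]
  obtain ⟨T, hT, hTfin, hcov⟩ := finite_approx_of_totallyBounded
    ((isCompact_closedBall (0 : E →L[ℝ] E) 1).totallyBounded.subset hsub) (δ / 4) (by positivity)
  have hnear : ∀ w, ∃ y ∈ T, dist (Φ.wordLin w) y < δ / 4 := fun w => by
    obtain ⟨y, hy, hwy⟩ := mem_iUnion₂.1 (hcov (mem_range_self w))
    exact ⟨y, hy, hwy⟩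
  choose! pre hpre using fun y (hy : y ∈ T) => hT hy
  refine ⟨pre '' T, hTfin.image _, fun w => ?_⟩
  -- By pigeonhole two powers of the isometry `O_w` share a net point, so some `O_w^(k+1)` is near
  -- `1`. Then `O_w^k` nearly inverts `O_w`, and the net point of `O_w^k` supplies `v`.
  choose p hp using fun n => exists_wordLin_eq_pow (Φ := Φ) w n
  choose c hcT hc using fun n => hnear (p n)
  have := hTfin.to_subtype
  obtain ⟨i, j, hij, hcij⟩ :
      ∃ i j : ℕ, i < j ∧ c i = c j := by
    obtain ⟨i, j, hne, heq⟩ := Finite.exists_ne_map_eq_of_infinite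
      (fun n : ℕ => (⟨c n, hcT n⟩ : T))
    have heq' : c i = c j := congrArg Subtype.val heq
    rcases hne.lt_or_gt with h | h
    exacts [⟨i, j, h, heq'⟩, ⟨j, i, h, heq'.symm⟩]
  obtain ⟨k, rfl⟩ := Nat.exists_eq_add_of_lt hij
  have hpow : ‖Φ.wordLin w ^ (k + 1) - 1‖ < δ / 2 := by
    have h1 : ‖Φ.wordLin w ^ (k + 1) - 1‖ = dist (Φ.wordLin (p (i + k + 1))) (Φ.wordLin (p i)) := by
      rw [dist_eq_norm, ← norm_wordLin_mul (Φ := Φ) (p i), hp, hp, mul_sub, mul_one, ← pow_add,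
        add_assoc]
    rw [h1]
    have h2 := dist_triangle_right (Φ.wordLin (p (i + k + 1))) (Φ.wordLin (p i)) (c i)
    have h3 := hc i
    have h4 := hc (i + k + 1)
    rw [← hcij] at h4
    linarith
  refine ⟨pre (c k), mem_image_of_mem _ (hcT k), ?_⟩
  rw [hpre _ (hcT k)]
  have hsplit : Φ.wordLin w * c k - 1 =
      Φ.wordLin w * (c k - Φ.wordLin (p k)) + (Φ.wordLin w ^ (k + 1) - 1) := by
    rw [hp, mul_sub, ← pow_succ']; abel
  have hck := hc k
  rw [dist_comm, dist_eq_norm] at hck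
  rw [hsplit]
  refine (norm_add_le _ _).trans_lt ?_
  rw [norm_wordLin_mul]
  linarith

/-- By linearity, the scaling and translation parts of the word map pass through `L`; only the
isometry part changes the shape of the image. -/
theorem content_image_piece_le {t : ℝ} (ht : 0 ≤ t) (L : E →L[ℝ] F) (w : List ι) :
    hausdorffPre t ∞ (L '' Φ.piece K w) ≤
      (Φ.wordRatio w : ℝ≥0∞) ^ t * hausdorffPre t ∞ ((L ∘L Φ.wordLin w) '' K) := by
  have himg : L '' Φ.piece K w = (fun y => (Φ.wordRatio w : ℝ) • y + L (Φ.wordMap w 0)) ''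
      ((L ∘L Φ.wordLin w) '' K) := by
    rw [piece, image_image, image_image]
    refine image_congr fun x _ => ?_
    rw [Φ.wordMap_eq w x]
    simp
  rw [himg]
  refine content_image_le ht (Φ.wordRatio_pos w).ne' (fun x y => ?_) _
  rw [edist_add_right, edist_smul₀, ENNReal.smul_def, smul_eq_mul]
  simp

variable (Φ) in
/-- The supremum of the Hausdorff contents of the images of `K` under `L` composed with the linear
parts of words. -/
noncomputable def orbitContent (K : Set E) (t : ℝ) (L : E →L[ℝ] F) : ℝ≥0∞ :=
  ⨆ w, hausdorffPre t ∞ ((L ∘L Φ.wordLin w) '' K)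

theorem content_le_orbitContent (t : ℝ) (L : E →L[ℝ] F) (w : List ι) :
    hausdorffPre t ∞ ((L ∘L Φ.wordLin w) '' K) ≤ Φ.orbitContent K t L :=
  le_iSup (fun w => hausdorffPre t ∞ ((L ∘L Φ.wordLin w) '' K)) w

theorem orbitContent_comp_le (t : ℝ) (L : E →L[ℝ] F) (w : List ι) :
    Φ.orbitContent K t (L ∘L Φ.wordLin w) ≤ Φ.orbitContent K t L := by
  refine iSup_le fun v => ?_
  have : (L ∘L Φ.wordLin w) ∘L Φ.wordLin v = L ∘L Φ.wordLin (w ++ v) := by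
    rw [wordLin_append]; rfl
  rw [this]
  exact content_le_orbitContent t L _

theorem orbitContent_lt_top (hK : IsCompact K) {t : ℝ} (ht : 0 ≤ t) (L : E →L[ℝ] F) :
    Φ.orbitContent K t L < ∞ := by
  refine lt_of_le_of_lt (iSup_le fun w => ?_) (ENNReal.rpow_lt_top_of_nonneg ht
    (ENNReal.mul_ne_top (ENNReal.coe_ne_top (r := ‖L‖₊)) hK.isBounded.ediam_ne_top))
  refine (hausdorffPre_le le_top).trans (ENNReal.rpow_le_rpow ?_ ht)
  have hlip : LipschitzWith 1 (Φ.wordLin w) := fun x y => by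
    rw [edist_eq_enorm_sub, edist_eq_enorm_sub, ← map_sub, ← ofReal_norm, norm_wordLin, ofReal_norm]
    simp
  have hcomp : LipschitzWith ‖L‖₊ (L ∘L Φ.wordLin w) := by
    have h := L.lipschitz.comp hlip
    rwa [mul_one] at h
  exact hcomp.ediam_image_le K

end SimilarityFamily

/-! ### Bounds on images and the case of positive dimension -/

namespace SimilarityFamily

variable {ι E F : Type*} [NormedAddCommGroup E] [NormedSpace ℝ E] [NormedAddCommGroup F]
  [NormedSpace ℝ F] {Φ : SimilarityFamily ι E} {K : Set E} [MeasurableSpace E] [BorelSpace E]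
  [MeasurableSpace F] [BorelSpace F]

/-- Each round applies the sharp density `M / μH[t] K` to a disjoint family of tiny pieces and
leaves a proportion `q`. After `n` rounds the crude Lipschitz bound is paid only on a proportion `q
^ n`. -/
theorem hausdorffMeasure_image_inter_open_le_add (hK : IsCompact K)
    (hinv : K = ⋃ i, Φ.letterMap i '' K) {t : ℝ≥0} (hpos : μH[t] K ≠ 0) (hfin : μH[t] K ≠ ∞)
    {q : ℝ≥0∞}
    (hq : ∀ U : Set E, IsOpen U → ∀ ε : ℝ≥0, 0 < ε →
      ∃ W : Finset (List ι), (∀ w ∈ W, Φ.wordRatio w ≤ ε ∧ Φ.piece K w ⊆ U) ∧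
        (W : Set (List ι)).PairwiseDisjoint (Φ.piece K) ∧
        μH[t] ((K ∩ U) \ ⋃ w ∈ W, Φ.piece K w) ≤ q * μH[t] (K ∩ U))
    (L : E →L[ℝ] F) (n : ℕ) : ∀ U : Set E, IsOpen U → μH[t] (L '' (K ∩ U)) ≤
      (Φ.orbitContent K t L / μH[t] K + q ^ n * (‖L‖₊ : ℝ≥0∞) ^ (t : ℝ)) * μH[t] (K ∩ U) := by
  induction n with
  | zero =>
    intro U _
    refine (L.lipschitz.hausdorffMeasure_image_le t.coe_nonneg (K ∩ U)).trans ?_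
    rw [pow_zero, one_mul]
    exact mul_le_mul_left le_add_self _
  | succ n ih =>
    intro U hU
    obtain ⟨D, hD⟩ : ∃ D : ℝ≥0, (D : ℝ≥0∞) = ediam K :=
      ⟨_, ENNReal.coe_toNNReal hK.isBounded.ediam_ne_top⟩
    refine hausdorffMeasure_le_of_forall_pre one_pos fun δ hδ _ => ?_
    obtain ⟨ε, hε, _, _, _, hεδ⟩ := exists_small_scale (‖L‖₊ * D) hδ one_pos one_pos
    obtain ⟨W, hW, hdisj, hWq⟩ := hq U hU ε hε
    set G := ⋃ w ∈ W, Φ.piece K w with hG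
    set M := Φ.orbitContent K t L with hM
    have hGclosed : IsClosed G :=
      W.finite_toSet.isClosed_biUnion fun w _ => (isCompact_piece hK w).isClosed
    have hGsub : G ⊆ K ∩ U :=
      iUnion₂_subset fun w hw => subset_inter (piece_subset hinv w) (hW w hw).2
    have hGmeas : μH[t] G = (∑ w ∈ W, (Φ.wordRatio w : ℝ≥0∞) ^ (t : ℝ)) * μH[t] K :=
      hausdorffMeasure_biUnion_piece hK t.coe_nonneg hdisj
    have hpiece : hausdorffPre t δ (L '' G) ≤ M / μH[t] K * μH[t] G := by
      rw [hG, image_iUnion₂]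
      refine (measure_biUnion_finset_le W _).trans ?_
      rw [← hG, hGmeas]
      calc ∑ w ∈ W, hausdorffPre t δ (L '' Φ.piece K w)
          ≤ ∑ w ∈ W, (Φ.wordRatio w : ℝ≥0∞) ^ (t : ℝ) * M := by
            refine Finset.sum_le_sum fun w hw => ?_
            refine (hausdorffPre_le_top_of_ediam_le t ?_ t.coe_nonneg).trans
              ((content_image_piece_le t.coe_nonneg L w).trans ?_)
            · refine (L.lipschitz.ediam_image_le _).trans (le_trans ?_ hεδ)
              calc (‖L‖₊ : ℝ≥0∞) * ediam (Φ.piece K w)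
                  ≤ ‖L‖₊ * (Φ.wordRatio w * D) := by
                    rw [hD]; gcongr; exact ediam_piece_le w
                _ ≤ ‖L‖₊ * (ε * D) := by gcongr; exact (hW w hw).1
                _ ≤ _ := by
                  have : ‖L‖₊ * (ε * D) ≤ 3 * ε * (‖L‖₊ * D) := by
                    calc ‖L‖₊ * (ε * D) = 1 * (ε * (‖L‖₊ * D)) := by ring
                      _ ≤ 3 * (ε * (‖L‖₊ * D)) := by gcongr; norm_num
                      _ = _ := by ring
                  exact_mod_cast this
            · gcongr
              exact content_le_orbitContent _ L w
        _ = M / μH[t] K * ((∑ w ∈ W, (Φ.wordRatio w : ℝ≥0∞) ^ (t : ℝ)) * μH[t] K) := by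
            rw [← Finset.sum_mul]
            have : M / μH[t] K * μH[t] K = M := ENNReal.div_mul_cancel hpos hfin
            calc _ = (∑ w ∈ W, (Φ.wordRatio w : ℝ≥0∞) ^ (t : ℝ)) * (M / μH[t] K * μH[t] K) := by
                  rw [this]
              _ = _ := by ring
    have hrest : hausdorffPre t δ (L '' ((K ∩ U) \ G)) ≤
        (M / μH[t] K + q ^ n * (‖L‖₊ : ℝ≥0∞) ^ (t : ℝ)) * μH[t] ((K ∩ U) \ G) := by
      refine (hausdorffPre_le_hausdorffMeasure _ hδ _).trans ?_
      -- `G` is closed, so the remainder is again an open part of `K`.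
      have heq : (K ∩ U) \ G = K ∩ (U \ G) := inter_sdiff_assoc K U G
      rw [heq]
      exact ih (U \ G) (hU.sdiff hGclosed)
    have hsplit : μH[t] G + μH[t] ((K ∩ U) \ G) = μH[t] (K ∩ U) := by
      have := measure_inter_add_sdiff (μ := μH[t]) (K ∩ U) hGclosed.measurableSet
      rwa [inter_eq_self_of_subset_right hGsub] at this
    calc hausdorffPre t δ (L '' (K ∩ U))
        = hausdorffPre t δ (L '' G ∪ L '' ((K ∩ U) \ G)) := by
          rw [← image_union, union_sdiff_cancel hGsub]
      _ ≤ M / μH[t] K * μH[t] G +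
          (M / μH[t] K + q ^ n * (‖L‖₊ : ℝ≥0∞) ^ (t : ℝ)) * μH[t] ((K ∩ U) \ G) :=
          (measure_union_le _ _).trans (add_le_add hpiece hrest)
      _ = M / μH[t] K * (μH[t] G + μH[t] ((K ∩ U) \ G)) +
          q ^ n * (‖L‖₊ : ℝ≥0∞) ^ (t : ℝ) * μH[t] ((K ∩ U) \ G) := by ring
      _ ≤ M / μH[t] K * μH[t] (K ∩ U) +
          q ^ n * (‖L‖₊ : ℝ≥0∞) ^ (t : ℝ) * (q * μH[t] (K ∩ U)) := by
          rw [hsplit]; gcongr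
      _ = _ := by ring

/-- The image of a part of `K` under `L` has measure at most `orbitContent / μH[t] K` times that of
the part. -/
theorem hausdorffMeasure_image_le [Finite ι] (hK : IsCompact K) (hne : K.Nonempty)
    (hinv : K = ⋃ i, Φ.letterMap i '' K) {t : ℝ≥0} (hdim : dimH K ≤ t) (hpos : μH[t] K ≠ 0)
    (L : E →L[ℝ] F) {A : Set E} (hA : A ⊆ K) :
    μH[t] (L '' A) ≤ Φ.orbitContent K t L / μH[t] K * μH[t] A := by
  have hfin := (hausdorffMeasure_lt_top hK hne hinv hdim).ne
  have hMfin : Φ.orbitContent K t L / μH[t] K ≠ ∞ :=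
    ENNReal.div_ne_top (orbitContent_lt_top hK t.coe_nonneg L).ne hpos
  obtain ⟨q, hq1, hq⟩ := exists_disjoint_family_measure_diff_le hK hne hinv hdim hpos
  have hopen : ∀ U : Set E, IsOpen U →
      μH[t] (L '' (K ∩ U)) ≤ Φ.orbitContent K t L / μH[t] K * μH[t] (K ∩ U) := by
    intro U hU
    have hΛ : (‖L‖₊ : ℝ≥0∞) ^ (t : ℝ) ≠ ∞ :=
      ENNReal.rpow_ne_top_of_nonneg t.coe_nonneg ENNReal.coe_ne_top
    have hUfin : μH[t] (K ∩ U) ≠ ∞ := ne_top_of_le_ne_top hfin (measure_mono inter_subset_left)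
    have h1 : Tendsto (fun n : ℕ => q ^ n * (‖L‖₊ : ℝ≥0∞) ^ (t : ℝ)) atTop (𝓝 0) := by
      simpa using ENNReal.Tendsto.mul_const
        (ENNReal.tendsto_pow_atTop_nhds_zero_of_lt_one hq1) (Or.inr hΛ)
    have h2 := ENNReal.Tendsto.mul_const
      (h1.const_add (Φ.orbitContent K t L / μH[t] K)) (Or.inr hUfin)
    rw [add_zero] at h2
    exact ge_of_tendsto' h2 fun n =>
      hausdorffMeasure_image_inter_open_le_add hK hinv hpos hfin hq L n U hU
  have hfinm : IsFiniteMeasure ((μH[t] : Measure E).restrict K) :=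
    ⟨by rwa [Measure.restrict_apply_univ, lt_top_iff_ne_top]⟩
  have hrestr : ∀ B : Set E, (μH[t] : Measure E).restrict K B = μH[t] (K ∩ B) := fun B => by
    rw [Measure.restrict_apply' hK.measurableSet, inter_comm]
  have hAK : K ∩ A = A := inter_eq_self_of_subset_right hA
  -- Outer regularity of the finite restricted measure passes from open parts to arbitrary `A`,
  -- measurable or not.
  have happ : ∀ r, μH[t] A < r →
      μH[t] (L '' A) ≤ Φ.orbitContent K t L / μH[t] K * r := by
    intro r hr
    obtain ⟨U, hAU, hU, hUr⟩ := A.exists_isOpen_lt_of_lt (μ := (μH[t] : Measure E).restrict K) r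
      (by rwa [hrestr, hAK])
    rw [hrestr] at hUr
    exact (measure_mono (image_mono (subset_inter hA hAU))).trans
      ((hopen U hU).trans (by gcongr))
  have hAfin : μH[t] A ≠ ∞ := ne_top_of_le_ne_top hfin (measure_mono hA)
  have hlim : Tendsto (fun r => Φ.orbitContent K t L / μH[t] K * r) (𝓝[>] (μH[t] A))
      (𝓝 (Φ.orbitContent K t L / μH[t] K * μH[t] A)) :=
    (ENNReal.Tendsto.const_mul tendsto_id (Or.inr hMfin)).mono_left nhdsWithin_le_nhds
  have hnb : (𝓝[>] (μH[t] A)).NeBot := nhdsGT_neBot_of_exists_gt ⟨∞, hAfin.lt_top⟩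
  exact ge_of_tendsto hlim (eventually_mem_nhdsWithin.mono happ)

/-- The orbit content is attained at `L` itself. -/
theorem orbitContent_le_content [Finite ι] [FiniteDimensional ℝ E] (hK : IsCompact K)
    (hne : K.Nonempty) (hinv : K = ⋃ i, Φ.letterMap i '' K) {t : ℝ≥0} (ht : 0 < t)
    (hdim : dimH K ≤ t) (hpos : μH[t] K ≠ 0) (L : E →L[ℝ] F) :
    Φ.orbitContent K t L ≤ hausdorffPre t ∞ (L '' K) := by
  by_contra! hlt
  have hfin := (hausdorffMeasure_lt_top hK hne hinv hdim).ne
  set M := Φ.orbitContent K t L with hM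
  have hMfin : M ≠ ∞ := (orbitContent_lt_top hK t.coe_nonneg L).ne
  obtain ⟨η, hη, hηM⟩ := exists_between hlt
  obtain ⟨δ, hδ, hδη⟩ := exists_content_image_comp_le (by exact_mod_cast ht) hK L hη
  obtain ⟨V, hV, hVw⟩ := Φ.exists_finite_approx_inverse hδ
  have hVne : V.Nonempty := by
    obtain ⟨v, hv, _⟩ := hVw []
    exact ⟨v, hv⟩
  obtain ⟨u, _, hu⟩ := exists_min_image V Φ.wordRatio hV hVne
  -- The deficit is uniform in `w` because `V` is finite and `u` has its smallest ratio.
  set x : ℝ≥0∞ := (Φ.wordRatio u : ℝ≥0∞) ^ (t : ℝ) * (M - η) with hx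
  have hx0 : x ≠ 0 := by
    refine mul_ne_zero ?_ (tsub_pos_of_lt hηM).ne'
    have := (Φ.wordRatio_pos u).ne'
    simp [ENNReal.rpow_eq_zero_iff, this]
  have hstep : ∀ w, hausdorffPre t ∞ ((L ∘L Φ.wordLin w) '' K) + x ≤ M := by
    intro w
    obtain ⟨v, hv, hwv⟩ := hVw w
    set p : ℝ≥0∞ := (Φ.wordRatio v : ℝ≥0∞) ^ (t : ℝ) with hp
    have hp1 : p ≤ 1 := ENNReal.rpow_le_one (by exact_mod_cast wordRatio_le_one v) t.coe_nonneg
    have hpfin : p * μH[t] K ≠ ∞ :=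
      ENNReal.mul_ne_top (ne_top_of_le_ne_top ENNReal.one_ne_top hp1) hfin
    have h1 : hausdorffPre t ∞ ((L ∘L Φ.wordLin w) '' Φ.piece K v) ≤ p * η := by
      have hcomp : (L ∘L Φ.wordLin w) ∘L Φ.wordLin v = L ∘L (Φ.wordLin w * Φ.wordLin v) := rfl
      have h0 := content_image_piece_le (Φ := Φ) (K := K) t.coe_nonneg (L ∘L Φ.wordLin w) v
      rw [hcomp] at h0
      exact h0.trans (mul_le_mul_right (hδη _ hwv) _)
    -- The density bound is applied to `L ∘L Φ.wordLin w`, whose orbit content is at most `M`.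
    have h2 : hausdorffPre t ∞ ((L ∘L Φ.wordLin w) '' (K \ Φ.piece K v)) ≤ M - p * M := by
      refine (hausdorffPre_le_hausdorffMeasure _ ENNReal.zero_lt_top _).trans
        ((hausdorffMeasure_image_le hK hne hinv hdim hpos (L ∘L Φ.wordLin w) sdiff_subset).trans ?_)
      rw [measure_sdiff (piece_subset hinv v) (isCompact_piece hK v).measurableSet.nullMeasurableSet
        (by rwa [hausdorffMeasure_piece t.coe_nonneg]), hausdorffMeasure_piece t.coe_nonneg]
      calc _ ≤ M / μH[t] K * (μH[t] K - p * μH[t] K) := by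
            gcongr; exact orbitContent_comp_le _ L w
        _ = M / μH[t] K * μH[t] K - p * (M / μH[t] K * μH[t] K) := by
            rw [ENNReal.mul_sub fun _ _ => ENNReal.div_ne_top hMfin hpos]
            congr 1; ring
        _ = M - p * M := by rw [ENNReal.div_mul_cancel hpos hfin]
    have h3 : hausdorffPre t ∞ ((L ∘L Φ.wordLin w) '' K) ≤ p * η + (M - p * M) := by
      calc _ = hausdorffPre t ∞ ((L ∘L Φ.wordLin w) '' Φ.piece K v ∪
            (L ∘L Φ.wordLin w) '' (K \ Φ.piece K v)) := by
            rw [← image_union, union_sdiff_cancel (piece_subset hinv v)]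
        _ ≤ _ := (measure_union_le _ _).trans (add_le_add h1 h2)
    have h4 : x ≤ p * (M - η) := by
      rw [hx]
      gcongr
      exact ENNReal.rpow_le_rpow (by exact_mod_cast hu v hv) t.coe_nonneg
    calc _ ≤ p * η + (M - p * M) + p * (M - η) := add_le_add h3 h4
      _ = p * (η + (M - η)) + (M - p * M) := by ring
      _ = p * M + (M - p * M) := by rw [add_tsub_cancel_of_le hηM.le]
      _ = M := add_tsub_cancel_of_le (mul_le_of_le_one_left' hp1)
  have : M + x ≤ M := by
    rw [hM, orbitContent, ENNReal.iSup_add]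
    exact iSup_le hstep
  exact this.not_gt (ENNReal.lt_add_right hMfin hx0)

/-- Almost disjoint parts of `K` have almost disjoint linear images, in dimension `t > 0`. -/
theorem hausdorffMeasure_image_inter_image_eq_zero [Finite ι] [FiniteDimensional ℝ E]
    (hK : IsCompact K) (hne : K.Nonempty) (hinv : K = ⋃ i, Φ.letterMap i '' K) {t : ℝ≥0}
    (ht : 0 < t) (hdim : dimH K ≤ t) (L : E →L[ℝ] F) {A B : Set E} (hAK : A ⊆ K) (hBK : B ⊆ K)
    (hAB : μH[t] (A ∩ B) = 0) (hA : μH[t] K = μH[t] (K \ A) + μH[t] (K ∩ A)) :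
    μH[t] (L '' A ∩ L '' B) = 0 := by
  have hnull : ∀ s : Set E, μH[t] s = 0 → μH[t] (L '' s) = 0 := fun s hs =>
    le_zero_iff.1 ((L.lipschitz.hausdorffMeasure_image_le t.coe_nonneg s).trans
      (by rw [hs, mul_zero]))
  by_cases hpos : μH[t] K = 0
  · exact measure_mono_null inter_subset_left (hnull A (measure_mono_null hAK hpos))
  have hfin := (hausdorffMeasure_lt_top hK hne hinv hdim).ne
  set M := Φ.orbitContent K t L with hM
  have hMfin : M ≠ ∞ := (orbitContent_lt_top hK t.coe_nonneg L).ne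
  have hsum : μH[t] (L '' A) + μH[t] (L '' (K \ A)) ≤ M := by
    calc _ ≤ M / μH[t] K * μH[t] A + M / μH[t] K * μH[t] (K \ A) :=
          add_le_add (hausdorffMeasure_image_le hK hne hinv hdim hpos L hAK)
            (hausdorffMeasure_image_le hK hne hinv hdim hpos L sdiff_subset)
      _ = M / μH[t] K * μH[t] K := by
          rw [inter_eq_self_of_subset_right hAK] at hA
          rw [hA, mul_add, add_comm]
      _ = M := ENNReal.div_mul_cancel hpos hfin
  have hle : M ≤ μH[t] (L '' A ∪ L '' (K \ A)) := by
    rw [← image_union, union_sdiff_cancel hAK]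
    exact (orbitContent_le_content hK hne hinv ht hdim hpos L).trans
      (hausdorffPre_le_hausdorffMeasure _ ENNReal.zero_lt_top _)
  have hinter := measure_inter_eq_zero_of_add_le (ne_top_of_le_ne_top hMfin hsum) (hsum.trans hle)
  refine measure_mono_null ?_ (measure_union_null hinter (hnull _ hAB))
  rintro y ⟨hyA, x, hxB, rfl⟩
  by_cases hxA : x ∈ A
  · exact Or.inr (mem_image_of_mem L ⟨hxA, hxB⟩)
  · exact Or.inl ⟨hyA, mem_image_of_mem L ⟨hBK hxB, hxA⟩⟩

/-- A self-similar set of dimension zero is a single point. -/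
theorem subsingleton_of_dimH_eq_zero [Finite ι] (hK : IsCompact K)
    (hinv : K = ⋃ i, Φ.letterMap i '' K) (hdim : dimH K = 0) : K.Subsingleton := by
  classical
  intro x hx y hy
  by_contra hxy
  obtain ⟨σ, hσ, hσ1, hcut⟩ := exists_mem_piece ⟨x, hx⟩ hinv
  obtain ⟨D, hD⟩ : ∃ D : ℝ≥0, (D : ℝ≥0∞) = ediam K :=
    ⟨_, ENNReal.coe_toNNReal hK.isBounded.ediam_ne_top⟩
  -- `D + 1` makes the separation of the two pieces strict. Two disjoint pieces then violate the
  -- counting bound with exponent `0`, which allows only one.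
  obtain ⟨ρ, hρ, hρ1, _, _, hle⟩ := exists_small_scale (D + 1) (edist_pos.2 hxy) one_pos one_pos
  obtain ⟨v, hxv, hv1, hv2⟩ := hcut ρ hρ hρ1 x hx
  obtain ⟨w, hyw, hw1, hw2⟩ := hcut ρ hρ hρ1 y hy
  have hsmall : ∀ u, Φ.wordRatio u ≤ ρ → ediam (Φ.piece K u) ≤ (ρ * D : ℝ≥0) := fun u hu => by
    refine (ediam_piece_le u).trans ?_
    rw [ENNReal.coe_mul, hD]
    gcongr
  have hdisj : Disjoint (Φ.piece K v) (Φ.piece K w) := by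
    rw [Set.disjoint_left]
    intro z hzv hzw
    have h1 := (edist_le_ediam_of_mem hxv hzv).trans (hsmall v hv2)
    have h2 := (edist_le_ediam_of_mem hzw hyw).trans (hsmall w hw2)
    have h3 := hle.trans ((edist_triangle x z y).trans (add_le_add h1 h2))
    have h4 : 3 * ρ * (D + 1) ≤ ρ * D + ρ * D := by exact_mod_cast h3
    have h5 : ρ * D + ρ * D < 3 * ρ * (D + 1) := by
      have : 3 * ρ * (D + 1) = ρ * D + ρ * D + (ρ * D + 3 * ρ) := by ring
      rw [this]
      exact lt_add_of_pos_right _ (by positivity)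
    exact h4.not_gt h5
  have hvw : v ≠ w := fun h => by
    rw [h, disjoint_self] at hdisj
    exact (nonempty_of_mem hyw).ne_empty hdisj
  have := card_mul_rpow_le_one hK ⟨x, hx⟩ hinv (t := 0) (by rw [hdim]; simp) (mul_pos hσ hρ)
    (lt_of_le_of_lt (mul_le_of_le_one_right' hρ1) hσ1) {v, w}
    (by simp only [Finset.mem_insert, Finset.mem_singleton, forall_eq_or_imp, forall_eq]
        exact ⟨hv1, hw1⟩)
    (by rw [Finset.coe_pair]; exact pairwise_pair.2 fun _ => ⟨hdisj, hdisj.symm⟩)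
  rw [Finset.card_pair hvw] at this
  norm_num at this

end SimilarityFamily

end SelfSimilar

/-! ### Linear parts of similarities and the final theorem -/

open SelfSimilar in
theorem IsSelfSimilarIFS.exists_similarityFamily {d m : ℕ}
    {S : Fin m → EuclideanSpace ℝ (Fin d) → EuclideanSpace ℝ (Fin d)} (hS : IsSelfSimilarIFS S) :
    ∃ Φ : SimilarityFamily (Fin m) (EuclideanSpace ℝ (Fin d)), ∀ i, Φ.letterMap i = S i := by
  choose r hr0 hr1 hr using hS
  -- Rescaling gives an isometry of a strictly convex space, which is affine even without assuming
  -- surjectivity.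
  have hiso : ∀ i, Isometry fun x => (r i)⁻¹ • S i x := fun i => by
    refine Isometry.of_dist_eq fun x y => ?_
    rw [dist_smul₀, hr, Real.norm_of_nonneg (inv_nonneg.2 (hr0 i).le), ← mul_assoc,
      inv_mul_cancel₀ (hr0 i).ne', one_mul]
  let Φ : SimilarityFamily (Fin m) (EuclideanSpace ℝ (Fin d)) :=
    { ratio := fun i => ⟨r i, (hr0 i).le⟩
      lin := fun i =>
        (hiso i).affineIsometryOfStrictConvexSpace.linearIsometry.toContinuousLinearMap
      trans := fun i => S i 0
      ratio_pos := fun i => hr0 i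
      ratio_lt_one := fun i => hr1 i
      norm_lin := fun i x => LinearIsometry.norm_map _ x }
  refine ⟨Φ, fun i => funext fun x => ?_⟩
  have h := (hiso i).affineIsometryOfStrictConvexSpace.map_vadd 0 x
  simp only [vadd_eq_add, add_zero, Isometry.affineIsometryOfStrictConvexSpace_apply] at h
  have h2 : Φ.lin i x = (r i)⁻¹ • S i x - (r i)⁻¹ • S i 0 := by
    rw [h, add_sub_cancel_right]; rfl
  change r i • Φ.lin i x + S i 0 = S i x
  rw [h2, smul_sub, smul_inv_smul₀ (hr0 i).ne', smul_inv_smul₀ (hr0 i).ne', sub_add_cancel]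

theorem mainTheorem6 {d d₂ m : ℕ}
    (S : Fin m → EuclideanSpace ℝ (Fin d) → EuclideanSpace ℝ (Fin d))
    (hS : IsSelfSimilarIFS S)
    (K : Set (EuclideanSpace ℝ (Fin d))) (hK : IsAttractor S K)
    -- `dimH K ≤ d` is finite, so `toReal` loses nothing
    (t : ℝ) (ht : t = (dimH K).toReal)
    (L : EuclideanSpace ℝ (Fin d) →ₗ[ℝ] EuclideanSpace ℝ (Fin d₂))
    (A B : Set (EuclideanSpace ℝ (Fin d))) (hAK : A ⊆ K) (hBK : B ⊆ K)
    (hAB : μH[t] (A ∩ B) = 0) (hA : IsHausdorffMeasurable t A) :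
    μH[t] ((L '' A) ∩ (L '' B)) = 0 := by
  obtain ⟨Φ, hΦ⟩ := hS.exists_similarityFamily
  have hinv : K = ⋃ i, Φ.letterMap i '' K := by
    simp only [hΦ]; exact hK.eq_iUnion
  have hfin : dimH K ≠ ⊤ := by
    refine ne_top_of_le_ne_top ?_ (dimH_mono (Set.subset_univ K))
    rw [Real.dimH_univ_eq_finrank]
    exact ENNReal.natCast_ne_top _
  obtain ⟨s, hs⟩ : ∃ s : NNReal, (s : ENNReal) = dimH K := ⟨_, ENNReal.coe_toNNReal hfin⟩
  obtain rfl : t = s := by rw [ht, ← hs]; rfl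
  -- The content argument needs `t > 0`. In dimension zero `K` is a point, and `L '' A ∩ L '' B`
  -- lies in `L '' (A ∩ B)`.
  rcases eq_or_ne s 0 with rfl | hs0
  · have hsub := SelfSimilar.SimilarityFamily.subsingleton_of_dimH_eq_zero hK.isCompact
      hinv (by simpa using hs.symm)
    refine measure_mono_null (t := L '' (A ∩ B)) ?_ ?_
    · rintro _ ⟨⟨x, hx, rfl⟩, y, hy, _⟩
      exact ⟨x, ⟨hx, hsub (hBK hy) (hAK hx) ▸ hy⟩, rfl⟩
    · refine le_zero_iff.1 ((L.toContinuousLinearMap.lipschitz.hausdorffMeasure_image_le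
        (NNReal.coe_nonneg 0) (A ∩ B)).trans ?_)
      rw [hAB, mul_zero]
  · exact SelfSimilar.SimilarityFamily.hausdorffMeasure_image_inter_image_eq_zero hK.isCompact
      hK.nonempty hinv
      (pos_iff_ne_zero.2 hs0) hs.ge L.toContinuousLinearMap hAK hBK hAB (hA K)
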